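/- Let $(L_n)_{n\ge 1}$ be the Lucas numbers, defined by $L_1=1$, $L_2=3$ and $L_{n+1}=L_{n-1}+L_n$ for $n\ge 2$. For an integer $m\ge 2$, say that the Lucas numbers are complete mod $m$ if every residue class mod $m$ contains some $L_n$ with $n\ge 1$. **Theorem.** Let $m\ge 2$ be an integer. The Lucas numbers are complete mod $m$ if and only if $m\in\{2,4,6,7,14\}$ or $m=3^j$ for some integer $j\ge 1$. -/

import Mathlib

/-- The sequence `G n = G n (a, b)` determined by `G 1 = a`, `G 2 = b` and
`G (n + 1) = G (n - 1) + G n`. The sequence is meant for indices `n ≥ 1`; the value at `0` is the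
one forced by running the recurrence backwards. -/
def gibonacci (a b : ℤ) : ℕ → ℤ
  | 0 => b - a
  | 1 => a
  | n + 2 => gibonacci a b n + gibonacci a b (n + 1)

theorem gibonacci_one (a b : ℤ) : gibonacci a b 1 = a := by
  simp [gibonacci]

theorem gibonacci_two (a b : ℤ) : gibonacci a b 2 = b := by
  simp [gibonacci]

theorem gibonacci_add_two (a b : ℤ) (n : ℕ) :
    gibonacci a b (n + 2) = gibonacci a b n + gibonacci a b (n + 1) := by
  rw [gibonacci]

/-- The Lucas numbers `1, 3, 4, 7, 11, 18, …`, with `lucas 1 = 1` and `lucas 2 = 3`. -/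
def lucas : ℕ → ℤ := gibonacci 1 3

/-- The sequence `s 1, s 2, s 3, …` is complete mod `m` if it contains every residue mod `m`. -/
def CompleteMod (s : ℕ → ℤ) (m : ℕ) : Prop :=
  ∀ r : ℤ, ∃ n : ℕ, 1 ≤ n ∧ s n ≡ r [ZMOD (m : ℤ)]

/-! Completeness passes to divisors, so incompleteness mod 5, 8, 12, 18, 21, 28, 49 and every prime
above 9 leaves only the listed moduli; all of these but the powers of 3 are finite checks. Powers of
3 lift: `L (n + 8·3^j) ≡ L n + 3^(j+1) L (n+2)` mod `3^(j+2)`, so shifting reaches all three lifts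
of a residue when `3 ∤ L (n+2)`. For a prime `p > 9`, if 5 is a square then Binet and Fermat give
the period `p - 1`, too short. Otherwise `L² - 5F² = ±4` excludes any `x` with `x² - 4` and `x² + 4`
both nonzero squares, and such an `x` exists. -/

theorem lucas_add_two (n : ℕ) : lucas (n + 2) = lucas n + lucas (n + 1) :=
  gibonacci_add_two 1 3 n

theorem lucas_zero : lucas 0 = 2 := by simp [lucas, gibonacci]

theorem lucas_one : lucas 1 = 1 := by simp [lucas, gibonacci]

theorem CompleteMod.of_dvd {s : ℕ → ℤ} {m d : ℕ} (h : CompleteMod s m) (hd : d ∣ m) :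
    CompleteMod s d := by
  intro r
  obtain ⟨n, hn, hr⟩ := h r
  exact ⟨n, hn, hr.of_dvd (Int.natCast_dvd_natCast.mpr hd)⟩

/-! ### Small moduli -/

/-- The pair `(L n, L (n + 1))` reduced mod `m`. -/
def lucasPair (m : ℕ) : ℕ → ℕ × ℕ
  | 0 => (2 % m, 1 % m)
  | n + 1 => ((lucasPair m n).2, ((lucasPair m n).1 + (lucasPair m n).2) % m)

theorem lucasPair_cast (m n : ℕ) :
    (((lucasPair m n).1 : ℕ) : ZMod m) = lucas n ∧
      (((lucasPair m n).2 : ℕ) : ZMod m) = lucas (n + 1) := by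
  induction n with
  | zero => simp [lucasPair, lucas_zero, lucas_one]
  | succ n ih =>
    refine ⟨by simpa [lucasPair] using ih.2, ?_⟩
    simp [lucasPair, ih.1, ih.2, lucas_add_two]

theorem completeMod_of_lucasPair {m : ℕ} [NeZero m] (T : ℕ)
    (h : ∀ r < m, ∃ n < T, 1 ≤ n ∧ (lucasPair m n).1 = r) : CompleteMod lucas m := by
  intro r
  obtain ⟨n, -, hn, hr⟩ := h (r : ZMod m).val (ZMod.val_lt _)
  refine ⟨n, hn, (ZMod.intCast_eq_intCast_iff _ _ _).mp ?_⟩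
  rw [← (lucasPair_cast m n).1, hr, ZMod.natCast_zmod_val]

theorem lucasPair_mod {m T : ℕ} (hT : lucasPair m T = lucasPair m 0) (n : ℕ) :
    lucasPair m n = lucasPair m (n % T) := by
  have hper : ∀ k, lucasPair m (k + T) = lucasPair m k := by
    intro k
    induction k with
    | zero => simpa using hT
    | succ k ih => rw [Nat.add_right_comm]; simp only [lucasPair, ih]
  exact (Function.Periodic.map_mod_nat hper n).symm

theorem not_completeMod_of_lucasPair {m : ℕ} (T r : ℕ) (h0 : 0 < T) (hr : r < m)
    (hT : lucasPair m T = lucasPair m 0) (h : ∀ n < T, (lucasPair m n).1 ≠ r) :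
    ¬ CompleteMod lucas m := by
  intro hc
  obtain ⟨n, -, hn⟩ := hc r
  have hlt : ∀ n, (lucasPair m n).2 < m ∧ (lucasPair m n).1 < m := by
    intro n
    have hm : 0 < m := by omega
    induction n with
    | zero => exact ⟨Nat.mod_lt _ hm, Nat.mod_lt _ hm⟩
    | succ n ih => exact ⟨Nat.mod_lt _ hm, ih.1⟩
  apply h (n % T) (Nat.mod_lt _ h0)
  rw [← lucasPair_mod hT]
  have h1 := (lucasPair_cast m n).1
  rw [(ZMod.intCast_eq_intCast_iff _ _ _).mpr hn, Int.cast_natCast,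
    ZMod.natCast_eq_natCast_iff] at h1
  exact h1.eq_of_lt_of_lt (hlt n).2 hr

/-! ### Powers of three -/

/-- Shifting the index by `m` gives the linear combination `b * L n + a * L (n + 1)`. -/
def LucasShift (m : ℕ) (a b : ℤ) : Prop :=
  ∀ n, lucas (n + m) = b * lucas n + a * lucas (n + 1)

/-- These are the coefficients of `(b + aφ)³` reduced by `φ² = φ + 1`. -/
theorem LucasShift.three_mul {m : ℕ} {a b : ℤ} (h : LucasShift m a b) :
    LucasShift (3 * m) (2 * a ^ 3 + 3 * a ^ 2 * b + 3 * a * b ^ 2)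
      (a ^ 3 + 3 * a ^ 2 * b + b ^ 3) := by
  intro n
  have e : n + 3 * m = n + m + m + m := by ring
  have e1 : n + m + m + 1 = n + 1 + m + m := by ring
  have e2 : n + m + 1 = n + 1 + m := by ring
  have e3 : n + 1 + m + 1 = n + 2 + m := by ring
  rw [e, h, e1, h (n + m), h (n + 1 + m), e2, e3, h n, h (n + 1), h (n + 2),
    show n + 2 + 1 = n + 1 + 2 from rfl, lucas_add_two (n + 1),
    show n + 1 + 1 = n + 2 from rfl, lucas_add_two]
  ring

theorem lucasShift_eight : LucasShift 8 21 13 := by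
  intro n
  have h (k) := lucas_add_two (n + k)
  have h0 := h 0
  have h1 := h 1
  have h2 := h 2
  have h3 := h 3
  have h4 := h 4
  have h5 := h 5
  have h6 := h 6
  simp only [add_assoc, Nat.reduceAdd, add_zero] at h0 h1 h2 h3 h4 h5 h6
  linarith

theorem lucasShift_three_pow (j : ℕ) : ∃ x y : ℤ,
    LucasShift (8 * 3 ^ j) (3 ^ (j + 1) * (1 + 3 * x)) (1 + 3 ^ (j + 1) * (1 + 3 * y)) := by
  induction j with
  | zero => exact ⟨2, 1, by simpa using lucasShift_eight⟩
  | succ j ih =>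
    obtain ⟨x, y, h⟩ := ih
    have h3 := h.three_mul
    rw [show 3 * (8 * 3 ^ j) = 8 * 3 ^ (j + 1) by ring] at h3
    set s : ℤ := 3 ^ j with hs
    have e1 : (3 : ℤ) ^ (j + 1) = 3 * s := by rw [hs]; ring
    have e2 : (3 : ℤ) ^ (j + 1 + 1) = 9 * s := by rw [hs]; ring
    rw [e1] at h3
    rw [e2]
    set u := 1 + 3 * x with hu
    set w := 1 + 3 * y with hw
    set b := 1 + 3 * s * w with hb
    refine ⟨x + u * (2 * s ^ 2 * u ^ 2 + s * u * b + 2 * s * w + 3 * s ^ 2 * w ^ 2),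
      y + s ^ 2 * u ^ 3 + s * u ^ 2 * b + s * w ^ 2 + s ^ 2 * w ^ 3, ?_⟩
    convert h3 using 1
    · rw [hb, hu]; ring
    · rw [hb, hw]; ring

theorem lucas_mod_three (n : ℕ) : (lucas (n + 2) % 3 = 0 ↔ n % 4 = 0) := by
  have h : ((lucas (n + 2) : ℤ) : ZMod 3) = 0 ↔ n % 4 = 0 := by
    rw [← (lucasPair_cast 3 (n + 2)).1, lucasPair_mod (T := 8) (by decide) (n + 2)]
    have : (n + 2) % 8 < 8 := Nat.mod_lt _ (by norm_num)
    rw [show n % 4 = ((n + 2) % 8 + 2) % 4 by omega]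
    generalize (n + 2) % 8 = k at *
    revert k
    decide
  rw [← h, ZMod.intCast_zmod_eq_zero_iff_dvd]
  exact Int.dvd_iff_emod_eq_zero.symm

/-- The condition `n % 4 ≠ 0` says `3 ∤ L (n+2)`; shifts by `8·3^j` preserve it, so the lifting can
be iterated. -/
theorem lucas_three_pow (j : ℕ) (r : ℤ) :
    ∃ n : ℕ, n % 4 ≠ 0 ∧ lucas n ≡ r [ZMOD 3 ^ (j + 1)] := by
  induction j with
  | zero =>
    have : r % 3 = 0 ∨ r % 3 = 1 ∨ r % 3 = 2 := by omega
    simp only [zero_add, pow_one, Int.ModEq]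
    rcases this with h | h | h
    · exact ⟨2, by norm_num, by rw [h]; simp [lucas, gibonacci]⟩
    · exact ⟨1, by norm_num, by rw [h]; simp [lucas, gibonacci]⟩
    · exact ⟨5, by norm_num, by rw [h]; simp [lucas, gibonacci]⟩
  | succ j ih =>
    obtain ⟨n, hn, hr⟩ := ih
    obtain ⟨x, y, hS⟩ := lucasShift_three_pow j
    obtain ⟨c, hc⟩ := hr.dvd
    have hne : lucas (n + 2) % 3 ≠ 0 := fun h => hn ((lucas_mod_three n).mp h)
    set q : ℤ := 3 ^ (j + 1) with hq
    have hq3 : q = 3 * 3 ^ j := by rw [hq]; ring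
    have step : ∀ k, ∃ z : ℤ, lucas (k + 8 * 3 ^ j) = lucas k + q * lucas (k + 2) + 3 * q * z :=
      fun k => ⟨y * lucas k + x * lucas (k + 1), by rw [hS k, lucas_add_two]; ring⟩
    obtain ⟨z, hz⟩ := step n
    obtain ⟨z', hz'⟩ := step (n + 2)
    obtain ⟨z'', hz''⟩ := step (n + 8 * 3 ^ j)
    rw [show n + 8 * 3 ^ j + 2 = n + 2 + 8 * 3 ^ j by ring, hz', hz] at hz''
    have e : (3 : ℤ) ^ (j + 1 + 1) = q * 3 := by rw [hq]; ring
    -- The number of shifts needed is 0, 1 or 2, according to `c / L (n+2)` mod 3.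
    have : (c % 3 = 0) ∨ (c - lucas (n + 2)) % 3 = 0 ∨ (c - 2 * lucas (n + 2)) % 3 = 0 := by
      have h1 : lucas (n + 2) % 3 = 1 ∨ lucas (n + 2) % 3 = 2 := by omega
      have h2 : c % 3 = 0 ∨ c % 3 = 1 ∨ c % 3 = 2 := by omega
      rcases h1 with h1 | h1 <;> rcases h2 with h2 | h2 | h2 <;> omega
    simp only [e]
    rcases this with h | h | h
    · refine ⟨n, hn, (Int.modEq_iff_dvd).mpr ?_⟩
      rw [hc]
      exact mul_dvd_mul_left _ (Int.dvd_of_emod_eq_zero h)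
    · refine ⟨n + 8 * 3 ^ j, by omega, (Int.modEq_iff_dvd).mpr ?_⟩
      obtain ⟨d, hd⟩ := Int.dvd_of_emod_eq_zero h
      exact ⟨d - z, by rw [hz]; linear_combination hc + q * hd⟩
    · refine ⟨n + 8 * 3 ^ j + 8 * 3 ^ j, by omega, (Int.modEq_iff_dvd).mpr ?_⟩
      obtain ⟨d, hd⟩ := Int.dvd_of_emod_eq_zero h
      refine ⟨d - z - z'' - 3 ^ j * (lucas (n + 2 + 2) + 3 * z'), ?_⟩
      rw [hz'']
      linear_combination hc + q * hd - q * (lucas (n + 2 + 2) + 3 * z') * hq3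

theorem completeMod_three_pow {j : ℕ} (hj : 1 ≤ j) : CompleteMod lucas (3 ^ j) := by
  intro r
  obtain ⟨k, rfl⟩ := Nat.exists_eq_add_of_le' hj
  obtain ⟨n, hn, hr⟩ := lucas_three_pow k r
  exact ⟨n, by omega, by exact_mod_cast hr⟩

/-! ### Prime moduli -/

theorem lucas_eq_fib (n : ℕ) : lucas n = 2 * Nat.fib (n + 1) - Nat.fib n := by
  induction n using Nat.twoStepInduction with
  | zero => simp [lucas_zero]
  | one => simp [lucas_one]
  | more n h1 h2 =>
    have e1 : Nat.fib (n + 2 + 1) = Nat.fib (n + 1) + Nat.fib (n + 2) := Nat.fib_add_two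
    have e2 : Nat.fib (n + 2) = Nat.fib n + Nat.fib (n + 1) := Nat.fib_add_two
    rw [lucas_add_two, h1, h2, e1, show n + 1 + 1 = n + 2 from rfl, e2]
    push_cast
    ring

theorem lucas_sq_sub (n : ℕ) : lucas n ^ 2 - 5 * (Nat.fib n : ℤ) ^ 2 = 4 * (-1) ^ n := by
  rw [lucas_eq_fib]
  induction n with
  | zero => simp
  | succ n ih =>
    rw [show n + 1 + 1 = n + 2 from rfl, Nat.fib_add_two, pow_succ]
    push_cast
    linear_combination -ih

/-- By `lucas_sq_sub`, `5F²` equals `y²` or `z²`, according to the parity of `n`. -/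
theorem isSquare_five_of_lucas {K : Type*} [Field K] {x y z : K} (hy : y ≠ 0) (hz : z ≠ 0)
    (h1 : x ^ 2 - 4 = y ^ 2) (h2 : x ^ 2 + 4 = z ^ 2) {n : ℕ} (hn : (lucas n : K) = x) :
    IsSquare (5 : K) := by
  have h : (lucas n : K) ^ 2 - 5 * (Nat.fib n : K) ^ 2 = 4 * (-1) ^ n := by
    exact_mod_cast congrArg (Int.cast : ℤ → K) (lucas_sq_sub n)
  rw [hn] at h
  have key : ∀ t : K, t ≠ 0 → 5 * (Nat.fib n : K) ^ 2 = t ^ 2 → IsSquare (5 : K) := by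
    intro t ht h5
    have hF : (Nat.fib n : K) ≠ 0 := by
      intro h0
      rw [h0] at h5
      exact ht (pow_eq_zero_iff (two_ne_zero) |>.mp (by linear_combination -h5))
    refine ⟨t / Nat.fib n, ?_⟩
    field_simp
    linear_combination h5
  rcases neg_one_pow_eq_or K n with h' | h' <;> rw [h'] at h
  · exact key y hy (by linear_combination h1 - h)
  · exact key z hz (by linear_combination h2 - h)

theorem lucas_eq_pow_add_pow {R : Type*} [CommRing R] {α β : R} (h1 : α + β = 1)
    (h2 : α * β = -1) (n : ℕ) : (lucas n : R) = α ^ n + β ^ n := by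
  induction n using Nat.twoStepInduction with
  | zero => simp [lucas_zero]; norm_num
  | one => simp [lucas_one, h1]
  | more n ih1 ih2 =>
    rw [lucas_add_two]
    push_cast
    rw [ih1, ih2]
    have ea : α ^ 2 = α + 1 := by linear_combination α * h1 - h2
    have eb : β ^ 2 = β + 1 := by linear_combination β * h1 - h2
    linear_combination -α ^ n * ea - β ^ n * eb

theorem not_completeMod_of_isSquare_five {p : ℕ} [Fact p.Prime] (hp2 : p ≠ 2)
    (h5 : IsSquare (5 : ZMod p)) : ¬ CompleteMod lucas p := by
  intro hc
  have hp := (Fact.out : p.Prime)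
  obtain ⟨s, hs⟩ := h5
  have h2 : (2 : ZMod p) ≠ 0 := by
    intro h
    have : p ∣ 2 := (ZMod.natCast_eq_zero_iff 2 p).mp (by exact_mod_cast h)
    exact hp2 ((Nat.prime_dvd_prime_iff_eq hp Nat.prime_two).mp this)
  set α : ZMod p := (1 + s) / 2
  set β : ZMod p := (1 - s) / 2
  have hab : α + β = 1 := by simp only [α, β]; field_simp; ring
  have hm : α * β = -1 := by
    simp only [α, β]; field_simp; linear_combination hs
  have ha : α ≠ 0 := by rintro h; simp [h] at hm
  have hb : β ≠ 0 := by rintro h; simp [h] at hm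
  have hper : Function.Periodic (fun n => (lucas n : ZMod p)) (p - 1) := by
    intro n
    simp only [lucas_eq_pow_add_pow hab hm, pow_add, ZMod.pow_card_sub_one_eq_one ha,
      ZMod.pow_card_sub_one_eq_one hb, mul_one]
  have hsurj : Function.Surjective (fun i : Fin (p - 1) => (lucas i : ZMod p)) := by
    intro r
    obtain ⟨n, -, hn⟩ := hc r.val
    refine ⟨⟨n % (p - 1), Nat.mod_lt _ (by have := hp.two_le; omega)⟩, ?_⟩
    have := hper.map_mod_nat n
    simp only at this ⊢
    rw [this, (ZMod.intCast_eq_intCast_iff _ _ _).mpr hn]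
    simp
  have := Fintype.card_le_of_surjective _ hsurj
  rw [ZMod.card, Fintype.card_fin] at this
  have := hp.two_le
  omega

/-- The van der Waerden bound `W(2,3) = 9`; the disjuncts list every progression in 1, …, 9. -/
theorem exists_three_term_progression (f : ℕ → Bool) :
    ∃ a d : ℕ, 1 ≤ d ∧ d < a ∧ a + d ≤ 9 ∧ f (a - d) = f a ∧ f (a + d) = f a := by
  have key : ∀ x1 x2 x3 x4 x5 x6 x7 x8 x9 : Bool,
      (x1 = x2 ∧ x3 = x2) ∨ (x2 = x3 ∧ x4 = x3) ∨ (x3 = x4 ∧ x5 = x4) ∨ (x4 = x5 ∧ x6 = x5) ∨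
      (x5 = x6 ∧ x7 = x6) ∨ (x6 = x7 ∧ x8 = x7) ∨ (x7 = x8 ∧ x9 = x8) ∨ (x1 = x3 ∧ x5 = x3) ∨
      (x2 = x4 ∧ x6 = x4) ∨ (x3 = x5 ∧ x7 = x5) ∨ (x4 = x6 ∧ x8 = x6) ∨ (x5 = x7 ∧ x9 = x7) ∨
      (x1 = x4 ∧ x7 = x4) ∨ (x2 = x5 ∧ x8 = x5) ∨ (x3 = x6 ∧ x9 = x6) ∨ (x1 = x5 ∧ x9 = x5) := by
    set_option synthInstance.maxSize 4096 in
    set_option synthInstance.maxHeartbeats 400000 in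
    decide +kernel
  rcases key (f 1) (f 2) (f 3) (f 4) (f 5) (f 6) (f 7) (f 8) (f 9) with
    h | h | h | h | h | h | h | h | h | h | h | h | h | h | h | h
  exacts [⟨2, 1, by simp, by simp, by simp, h⟩, ⟨3, 1, by simp, by simp, by simp, h⟩,
    ⟨4, 1, by simp, by simp, by simp, h⟩, ⟨5, 1, by simp, by simp, by simp, h⟩,
    ⟨6, 1, by simp, by simp, by simp, h⟩, ⟨7, 1, by simp, by simp, by simp, h⟩,
    ⟨8, 1, by simp, by simp, by simp, h⟩, ⟨3, 2, by simp, by simp, by simp, h⟩,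
    ⟨4, 2, by simp, by simp, by simp, h⟩, ⟨5, 2, by simp, by simp, by simp, h⟩,
    ⟨6, 2, by simp, by simp, by simp, h⟩, ⟨7, 2, by simp, by simp, by simp, h⟩,
    ⟨4, 3, by simp, by simp, by simp, h⟩, ⟨5, 3, by simp, by simp, by simp, h⟩,
    ⟨6, 3, by simp, by simp, by simp, h⟩, ⟨5, 4, by simp, by simp, by simp, h⟩]

/-- Some `a - d, a, a + d` in 1, …, 9 share a quadratic character. As -1 is a nonsquare, dividing by
`d` or `-d` gives consecutive squares `v - 1, v, v + 1`; take `x² = 4v`. -/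
theorem exists_sq_sub_four_sq_add_four {p : ℕ} [Fact p.Prime] (hp : 9 < p) (h4 : p % 4 = 3) :
    ∃ x y z : ZMod p, y ≠ 0 ∧ z ≠ 0 ∧ x ^ 2 - 4 = y ^ 2 ∧ x ^ 2 + 4 = z ^ 2 := by
  have hne : ∀ n : ℕ, 1 ≤ n → n ≤ 9 → (n : ZMod p) ≠ 0 := by
    intro n h1 h2 h
    have := Nat.le_of_dvd h1 ((ZMod.natCast_eq_zero_iff n p).mp h)
    omega
  have hneg : ¬ IsSquare (-1 : ZMod p) := by
    rw [ZMod.exists_sq_eq_neg_one_iff]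
    omega
  have h2 : (2 : ZMod p) ≠ 0 := by simpa using hne 2 (by norm_num) (by norm_num)
  have hχ : ∀ u : ZMod p, u ≠ 0 → ¬ IsSquare u → IsSquare (-u) := by
    intro u hu hn
    have hF : ringChar (ZMod p) ≠ 2 := by rw [ZMod.ringChar_zmod_n]; omega
    have e1 := quadraticChar_neg_one_iff_not_isSquare.mpr hn
    have e2 := quadraticChar_neg_one_iff_not_isSquare.mpr hneg
    rw [← quadraticChar_one_iff_isSquare (neg_ne_zero.mpr hu), neg_eq_neg_one_mul, map_mul, e1, e2]
    norm_num
  have key : ∀ v : ZMod p, v - 1 ≠ 0 → v + 1 ≠ 0 → IsSquare v → IsSquare (v - 1) →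
      IsSquare (v + 1) →
      ∃ x y z : ZMod p, y ≠ 0 ∧ z ≠ 0 ∧ x ^ 2 - 4 = y ^ 2 ∧ x ^ 2 + 4 = z ^ 2 := by
    rintro v n1 n2 ⟨x, hx⟩ ⟨y, hy⟩ ⟨z, hz⟩
    refine ⟨2 * x, 2 * y, 2 * z, mul_ne_zero h2 ?_, mul_ne_zero h2 ?_, ?_, ?_⟩
    · rintro rfl; simp_all
    · rintro rfl; simp_all
    · linear_combination -4 * hx + 4 * hy
    · linear_combination -4 * hx + 4 * hz
  classical
  obtain ⟨a, d, hd, hda, had, e1, e2⟩ :=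
    exists_three_term_progression (fun n => decide (IsSquare (n : ZMod p)))
  simp only [decide_eq_decide] at e1 e2
  have nd := hne d hd (by omega)
  have na := hne a (by omega) (by omega)
  have nm := hne (a - d) (by omega) (by omega)
  have np := hne (a + d) (by omega) (by omega)
  rw [Nat.cast_sub hda.le] at e1 nm
  rw [Nat.cast_add] at e2 np
  generalize (a : ZMod p) = a at *
  generalize (d : ZMod p) = d at *
  have main : ∀ ε : ZMod p, ε = 1 ∨ ε = -1 → IsSquare (ε * (a / d)) →
      IsSquare (ε * ((a - d) / d)) → IsSquare (ε * ((a + d) / d)) →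
      ∃ x y z : ZMod p, y ≠ 0 ∧ z ≠ 0 ∧ x ^ 2 - 4 = y ^ 2 ∧ x ^ 2 + 4 = z ^ 2 := by
    intro ε hε s0 s1 s2
    have f1 : (a - d) / d ≠ 0 := div_ne_zero nm nd
    have f2 : (a + d) / d ≠ 0 := div_ne_zero np nd
    rw [sub_div, div_self nd] at s1 f1
    rw [add_div, div_self nd] at s2 f2
    rcases hε with rfl | rfl
    · rw [one_mul] at s0 s1 s2
      exact key _ f1 f2 s0 s1 s2
    -- The sign exchanges the two neighbours of `v`.
    · refine key (-1 * (a / d)) ?_ ?_ s0 ?_ ?_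
      · intro h; exact f2 (by linear_combination -h)
      · intro h; exact f1 (by linear_combination -h)
      · convert s2 using 1; ring
      · convert s1 using 1; ring
  have e3 : ∀ u : ZMod p, -1 * (u / d) = u / -d := fun u => by rw [div_neg]; ring
  have e4 : ∀ u : ZMod p, -1 * (u / d) = -u / d := fun u => by rw [neg_div]; ring
  have e5 : ∀ u : ZMod p, 1 * (u / d) = -u / -d := fun u => by rw [neg_div_neg_eq, one_mul]
  by_cases sa : IsSquare a
  · by_cases sd : IsSquare d
    · refine main 1 (Or.inl rfl) ?_ ?_ ?_ <;> rw [one_mul]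
      exacts [sa.div sd, (e1.mpr sa).div sd, (e2.mpr sa).div sd]
    · have sd' := hχ d nd sd
      refine main (-1) (Or.inr rfl) ?_ ?_ ?_ <;> rw [e3]
      exacts [sa.div sd', (e1.mpr sa).div sd', (e2.mpr sa).div sd']
  · have t0 := hχ a na sa
    have t1 := hχ _ nm (mt e1.mp sa)
    have t2 := hχ _ np (mt e2.mp sa)
    by_cases sd : IsSquare d
    · refine main (-1) (Or.inr rfl) ?_ ?_ ?_ <;> rw [e4]
      exacts [t0.div sd, t1.div sd, t2.div sd]
    · have sd' := hχ d nd sd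
      refine main 1 (Or.inl rfl) ?_ ?_ ?_ <;> rw [e5]
      exacts [t0.div sd', t1.div sd', t2.div sd']

theorem not_completeMod_of_prime {p : ℕ} (hp : p.Prime) (h9 : 9 < p) : ¬ CompleteMod lucas p := by
  have := Fact.mk hp
  by_cases h5 : IsSquare (5 : ZMod p)
  · exact not_completeMod_of_isSquare_five (by omega) h5
  intro hc
  have hx : ∃ x y z : ZMod p, y ≠ 0 ∧ z ≠ 0 ∧ x ^ 2 - 4 = y ^ 2 ∧ x ^ 2 + 4 = z ^ 2 := by
    by_cases h4 : p % 4 = 3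
    · exact exists_sq_sub_four_sq_add_four h9 h4
    · obtain ⟨i, hi⟩ := ZMod.exists_sq_eq_neg_one_iff.mpr h4
      have h2 : (2 : ZMod p) ≠ 0 := by
        intro h
        have : p ∣ 2 := (ZMod.natCast_eq_zero_iff 2 p).mp (by exact_mod_cast h)
        have := Nat.le_of_dvd two_pos this
        omega
      have hi0 : i ≠ 0 := by rintro rfl; simp at hi
      exact ⟨0, 2 * i, 2, mul_ne_zero h2 hi0, h2, by linear_combination 4 * hi, by norm_num⟩
  obtain ⟨x, y, z, hy, hz, h1, h2⟩ := hx
  obtain ⟨n, -, hn⟩ := hc x.val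
  refine h5 (isSquare_five_of_lucas hy hz h1 h2 (n := n) ?_)
  rw [(ZMod.intCast_eq_intCast_iff _ _ _).mpr hn]
  simp

/-! ### The classification -/

theorem mainTheorem2 (m : ℕ) (hm : 2 ≤ m) :
    CompleteMod lucas m ↔
      m = 2 ∨ m = 4 ∨ m = 6 ∨ m = 7 ∨ m = 14 ∨ ∃ j : ℕ, 1 ≤ j ∧ m = 3 ^ j := by
  constructor
  · intro hc
    have bad : ∀ d, ¬ CompleteMod lucas d → ¬ d ∣ m := fun d hd h => hd (hc.of_dvd h)
    -- The numerals are a period and a missed residue.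
    have b5 := bad 5 (not_completeMod_of_lucasPair 4 0 (by decide) (by decide)
      (by decide +kernel) (by decide +kernel))
    have b8 := bad 8 (not_completeMod_of_lucasPair 12 0 (by decide) (by decide)
      (by decide +kernel) (by decide +kernel))
    have b12 := bad 12 (not_completeMod_of_lucasPair 24 0 (by decide) (by decide)
      (by decide +kernel) (by decide +kernel))
    have b18 := bad 18 (not_completeMod_of_lucasPair 24 5 (by decide) (by decide)
      (by decide +kernel) (by decide +kernel))
    have b21 := bad 21 (not_completeMod_of_lucasPair 16 0 (by decide) (by decide)
      (by decide +kernel) (by decide +kernel))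
    have b28 := bad 28 (not_completeMod_of_lucasPair 48 0 (by decide) (by decide)
      (by decide +kernel) (by decide +kernel))
    have b49 := bad 49 (not_completeMod_of_lucasPair 112 5 (by decide) (by decide)
      (by decide +kernel) (by decide +kernel))
    have hprime : ∀ q, q.Prime → q ∣ m → q = 2 ∨ q = 3 ∨ q = 7 := by
      intro q hq hqm
      have h9 : q ≤ 9 := not_lt.mp fun h => bad q (not_completeMod_of_prime hq h) hqm
      interval_cases q <;> first | omega | exact absurd hq (by norm_num)
    have hone : ∀ k, k ∣ m → ¬ 2 ∣ k → ¬ 3 ∣ k → ¬ 7 ∣ k → k = 1 := by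
      intro k hk h2 h3 h7
      by_contra h1
      obtain ⟨q, hq, hqk⟩ := Nat.exists_prime_and_dvd h1
      rcases hprime q hq (hqk.trans hk) with rfl | rfl | rfl <;> contradiction
    by_cases h7 : 7 ∣ m
    · obtain ⟨k, rfl⟩ := h7
      by_cases h2 : 2 ∣ k
      · obtain ⟨l, rfl⟩ := h2
        have := hone l ⟨14, by ring⟩ (by omega) (by omega) (by omega)
        omega
      · have := hone k ⟨7, by ring⟩ h2 (by omega) (by omega)
        omega
    by_cases h2 : 2 ∣ m
    · obtain ⟨k, rfl⟩ := h2
      by_cases h3 : 3 ∣ k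
      · obtain ⟨l, rfl⟩ := h3
        have := hone l ⟨6, by ring⟩ (by omega) (by omega) (by omega)
        omega
      by_cases h2 : 2 ∣ k
      · obtain ⟨l, rfl⟩ := h2
        have := hone l ⟨4, by ring⟩ (by omega) (by omega) (by omega)
        omega
      · have := hone k ⟨2, by ring⟩ h2 h3 (by omega)
        omega
    have hm3 := Nat.eq_prime_pow_of_unique_prime_dvd (p := 3) (n := m) (by omega) (by
      intro q hq hqm
      rcases hprime q hq hqm with rfl | rfl | rfl
      exacts [absurd hqm h2, rfl, absurd hqm h7])
    refine Or.inr <| Or.inr <| Or.inr <| Or.inr <| Or.inr ⟨_, ?_, hm3⟩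
    by_contra h0
    rw [Nat.lt_one_iff.mp (not_le.mp h0)] at hm3
    omega
  · rintro (rfl | rfl | rfl | rfl | rfl | ⟨j, hj, rfl⟩)
    -- Each bound is a period plus one, since index 0 is not allowed.
    · exact completeMod_of_lucasPair 4 (by decide +kernel)
    · exact completeMod_of_lucasPair 7 (by decide +kernel)
    · exact completeMod_of_lucasPair 25 (by decide +kernel)
    · exact completeMod_of_lucasPair 17 (by decide +kernel)
    · exact completeMod_of_lucasPair 49 (by decide +kernel)
    · exact completeMod_three_pow hj
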